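/- Let $G$ be a finite group, $p$ a prime, $H$ a normal subgroup of $G$ of index $p$, and $x\in G$ with $G/H=\langle xH\rangle$. For a finite-dimensional complex representation $\rho$ of a finite group $K$ with character $\chi_\rho$, put $e_\rho=\frac{\chi_\rho(1)}{|K|}\sum_{g\in K}\chi_\rho(g^{-1})\,g\in\mathbb{C}[K]$; if $\rho$ is irreducible, this is the primitive central idempotent of $\mathbb{C}[K]$ corresponding to $\rho$, that is, the one acting as the identity in $\rho$. For $y\in G$ let $\overline{C}(y)\in\mathbb{C}[G]$ be the sum of the elements of the conjugacy class of $y$ in $G$. Let $(\eta,W)$ be an irreducible complex representation of $H$, regard $\mathbb{C}[H]$ as a subring of $\mathbb{C}[G]$, and for $g\in G$ let $\eta^g(h)=\eta(ghg^{-1})$ for $h\in H$. (1) Suppose that $e_\eta$ is central in $\mathbb{C}[G]$. Then $\eta$ extends to exactly $p$ representations $\rho_0,\dots,\rho_{p-1}$ of $G$ on $W$; they are irreducible and pairwise inequivalent, and $$e_\eta=e_{\rho_0}+e_{\rho_1}+\cdots+e_{\rho_{p-1}}.$$ There are an element $y\in G$ with $G/H=\langle yH\rangle$ and a complex number $\lambda\neq0$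 such that $\overline{C}(y)^p\,e_\eta=\lambda e_\eta$. For all such $y$ and $\lambda$, every complex number $r$ with $r^p=\lambda$, and every primitive $p$-th root of unity $\zeta\in\mathbb{C}$, the representations $\rho_0,\dots,\rho_{p-1}$ can be renumbered so that, with $c=r^{-1}\,\overline{C}(y)\,e_\eta$, $$e_{\rho_i}=\frac1p\left(1+\zeta^{i}c+\zeta^{2i}c^2+\cdots+\zeta^{i(p-1)}c^{p-1}\right)e_\eta\qquad(0\le i\le p-1).$$ (2) Suppose that $e_\eta$ is not central in $\mathbb{C}[G]$. Then the induced representations $\eta\uparrow_H^G,\ \eta^{x}\uparrow_H^G,\ \dots,\ \eta^{x^{p-1}}\uparrow_H^G$ are all equivalent to one irreducible complex representation $\rho$ of $G$, and $$e_\rho=e_\eta+e_{\eta^x}+\cdots+e_{\eta^{x^{p-1}}}.$$ -/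

import Mathlib

noncomputable section

namespace GroupAlg

open Representation

universe uG

/-- `e` is a primitive central idempotent of the ring `R`: a nonzero central idempotent that
is minimal among the nonzero central idempotents. -/
structure IsPrimitiveCentralIdempotent {R : Type*} [Ring R] (e : R) : Prop where
  mem_center : e ∈ Set.center R
  idem : IsIdempotentElem e
  ne_zero : e ≠ 0
  minimal : ∀ f : R, f ∈ Set.center R → IsIdempotentElem f → f * e = f → f = 0 ∨ f = e

/-- The primitive central idempotent `e_ρ = (χ(1) / |G|) ∑ g, χ(g⁻¹) g` of `ℂ[G]` corresponding
to a (finite-dimensional, irreducible) complex representation `ρ` with character `χ`.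
See `eq_pci_iff` for its intrinsic characterization. -/
def pci {G : Type*} [Group G] {V : Type*} [AddCommGroup V] [Module ℂ V]
    (ρ : Representation ℂ G V) : MonoidAlgebra ℂ G :=
  ((Module.finrank ℂ V : ℂ) / (Nat.card G : ℂ)) •
    ∑ᶠ g : G, MonoidAlgebra.single g (ρ.character g⁻¹)

/-- The sum in `ℂ[G]` of all the elements of the conjugacy class of `x`. -/
def classSum {G : Type*} [Group G] (x : G) : MonoidAlgebra ℂ G :=
  ∑ᶠ g ∈ conjugatesOf x, MonoidAlgebra.single g (1 : ℂ)

/-- The inclusion `ℂ[H] → ℂ[G]` for a subgroup `H` of `G`. -/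
def incl {G : Type*} [Group G] (H : Subgroup G) : MonoidAlgebra ℂ H →+* MonoidAlgebra ℂ G :=
  MonoidAlgebra.mapDomainRingHom ℂ H.subtype

/-- The conjugate representation `η^g : h ↦ η (g h g⁻¹)` of a normal subgroup `H` of `G`. -/
def conjRep {G : Type*} [Group G] {H : Subgroup G} [H.Normal] {W : Type*} [AddCommGroup W]
    [Module ℂ W] (η : Representation ℂ H W) (g : G) : Representation ℂ H W :=
  η.comp (MulAut.conjNormal g).toMonoidHom

/-- An element of `ℂ[G]` acting by zero in every irreducible representation is zero. -/
theorem eq_zero_of_forall_irreducible {G : Type uG} [Group G] [Finite G] (a : MonoidAlgebra ℂ G)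
    (h : ∀ (V : Type uG) [AddCommGroup V] [Module ℂ V] [FiniteDimensional ℂ V]
      (σ : Representation ℂ G V), σ.IsIrreducible → σ.asAlgebraHom a = 0) : a = 0 := by
  have hk : ∀ S : Submodule (MonoidAlgebra ℂ G) (MonoidAlgebra ℂ G),
      IsSimpleModule (MonoidAlgebra ℂ G) S → ∀ m ∈ S, a * m = 0 := by
    intro S hS m hm
    let σ : Representation ℂ G S := ofModule' S
    have hact : ∀ (r : MonoidAlgebra ℂ G) (v : S), σ.asAlgebraHom r v = r • v := by
      intro r v
      have : σ.asAlgebraHom = Algebra.lsmul ℂ ℂ S :=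
        (MonoidAlgebra.lift ℂ (S →ₗ[ℂ] S) G).apply_symm_apply _
      rw [this]
      rfl
    have : FiniteDimensional ℂ S :=
      FiniteDimensional.finiteDimensional_submodule (S.restrictScalars ℂ)
    have hirr : σ.IsIrreducible := by
      rw [irreducible_iff_isSimpleModule_asModule]
      let e : σ.asModule ≃ₗ[MonoidAlgebra ℂ G] S :=
        { σ.asModuleEquiv with
          map_smul' := fun r v => hact r (σ.asModuleEquiv v) }
      exact IsSimpleModule.congr e
    have h2 := congrArg (fun f => f ⟨m, hm⟩) (h S σ hirr)
    simp only [hact] at h2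
    exact congrArg Subtype.val h2
  have : NeZero (Nat.card G : ℂ) := ⟨by simp [Nat.card_pos.ne']⟩
  have htop : sSup {S : Submodule (MonoidAlgebra ℂ G) (MonoidAlgebra ℂ G) |
      IsSimpleModule (MonoidAlgebra ℂ G) S} = ⊤ := IsSemisimpleModule.sSup_simples_eq_top _ _
  have h1 : (1 : MonoidAlgebra ℂ G) ∈ sSup {S : Submodule (MonoidAlgebra ℂ G) (MonoidAlgebra ℂ G) |
      IsSimpleModule (MonoidAlgebra ℂ G) S} := htop ▸ Submodule.mem_top
  have h2 : ∀ m ∈ sSup {S : Submodule (MonoidAlgebra ℂ G) (MonoidAlgebra ℂ G) |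
      IsSimpleModule (MonoidAlgebra ℂ G) S}, a * m = 0 := by
    intro m hm
    rw [sSup_eq_iSup'] at hm
    induction hm using Submodule.iSup_induction' with
    | mem S m hm => exact hk S.1 S.2 m hm
    | zero => simp
    | add x y _ _ hx hy => rw [mul_add, hx, hy, add_zero]
  simpa using h2 1 h1

/-- Central elements of `ℂ[G]` act as scalars in irreducible representations. -/
theorem exists_scalar {G : Type*} [Group G] [Finite G] {V : Type*} [AddCommGroup V] [Module ℂ V]
    [FiniteDimensional ℂ V] (σ : Representation ℂ G V) (hσ : σ.IsIrreducible)
    (a : MonoidAlgebra ℂ G) (ha : a ∈ Set.center (MonoidAlgebra ℂ G)) :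
    ∃ c : ℂ, σ.asAlgebraHom a = algebraMap ℂ (Module.End ℂ V) c := by
  let f : IntertwiningMap σ σ := ⟨σ.asAlgebraHom a, fun g => by
    have := (Set.mem_center_iff.1 ha).comm (MonoidAlgebra.of ℂ G g)
    have := congrArg σ.asAlgebraHom this.eq
    rw [map_mul, map_mul, asAlgebraHom_of] at this
    exact this⟩
  obtain ⟨c, hc⟩ := (IsIrreducible.algebraMap_intertwiningMap_bijective_of_isAlgClosed
    (ρ := σ)).2 f
  refine ⟨c, ?_⟩
  have := congrArg IntertwiningMap.toLinearMap hc
  rw [show σ.asAlgebraHom a = f.toLinearMap from rfl, ← this]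
  ext v
  rfl

theorem pci_eq_sum {G : Type*} [Group G] [Fintype G] {V : Type*} [AddCommGroup V] [Module ℂ V]
    (ρ : Representation ℂ G V) : pci ρ = ((Module.finrank ℂ V : ℂ) / (Nat.card G : ℂ)) •
      ∑ g : G, MonoidAlgebra.single g (ρ.character g⁻¹) := by
  rw [pci, finsum_eq_sum_of_fintype]

theorem pci_mem_center {G : Type*} [Group G] [Finite G] {V : Type*} [AddCommGroup V] [Module ℂ V]
    (ρ : Representation ℂ G V) : pci ρ ∈ Set.center (MonoidAlgebra ℂ G) := by
  have := Fintype.ofFinite G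
  rw [Semigroup.mem_center_iff]
  intro b
  induction b using MonoidAlgebra.induction_on with
  | of g =>
    rw [pci_eq_sum, MonoidAlgebra.of_apply, mul_smul_comm, smul_mul_assoc, Finset.mul_sum,
      Finset.sum_mul]
    congr 1
    refine Fintype.sum_equiv (MulAut.conj g).toEquiv _ _ fun k => ?_
    simp only [MonoidAlgebra.single_mul_single, one_mul, mul_one]
    have h1 : (MulAut.conj g).toEquiv k * g = g * k := by simp
    have h2 : ρ.character ((MulAut.conj g).toEquiv k)⁻¹ = ρ.character k⁻¹ := by
      have h3 : ((MulAut.conj g).toEquiv k)⁻¹ = g * k⁻¹ * g⁻¹ := by simp [mul_assoc]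
      rw [h3, ρ.char_mul_comm, inv_mul_cancel_left]
    rw [h1, h2]
  | add x y hx hy => rw [add_mul, mul_add, hx, hy]
  | smul r f hf => rw [smul_mul_assoc, mul_smul_comm, hf]

theorem nontrivial_of_irreducible {G : Type*} [Group G] {W : Type*} [AddCommGroup W] [Module ℂ W]
    (σ : Representation ℂ G W) (hσ : σ.IsIrreducible) : Nontrivial W := by
  by_contra hW
  have : Subsingleton W := not_nontrivial_iff_subsingleton.1 hW
  have : Subsingleton (Subrepresentation σ) :=
    ⟨fun a b => by ext v; rw [Subsingleton.elim v 0]; simp⟩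
  exact not_subsingleton (Subrepresentation σ) this

/-- `e_ρ` acts in an irreducible representation `σ` as the identity if `σ ≅ ρ`, and as zero
otherwise. -/
theorem asAlgebraHom_pci {G : Type*} [Group G] [Finite G] {V W : Type*} [AddCommGroup V]
    [Module ℂ V] [FiniteDimensional ℂ V] [AddCommGroup W] [Module ℂ W] [FiniteDimensional ℂ W]
    (ρ : Representation ℂ G V) (hρ : ρ.IsIrreducible)
    (σ : Representation ℂ G W) (hσ : σ.IsIrreducible) :
    (Nonempty (Representation.Equiv ρ σ) → σ.asAlgebraHom (pci ρ) = 1) ∧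
      (¬ Nonempty (Representation.Equiv ρ σ) → σ.asAlgebraHom (pci ρ) = 0) := by
  have := Fintype.ofFinite G
  obtain ⟨c, hc⟩ := exists_scalar σ hσ _ (pci_mem_center ρ)
  have hne : (Nat.card G : ℂ) ≠ 0 := by simp
  have : Invertible (Nat.card G : ℂ) := invertibleOfNonzero hne
  have horth := char_orthonormal σ ρ
  have : Nontrivial W := nontrivial_of_irreducible σ hσ
  have hd : (Module.finrank ℂ W : ℂ) ≠ 0 := by simp [Module.finrank_pos.ne']
  have htr := congrArg (LinearMap.trace ℂ W) hc
  have hl : LinearMap.trace ℂ W (σ.asAlgebraHom (pci ρ)) = (Module.finrank ℂ V : ℂ) *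
      ((Nat.card G : ℂ)⁻¹ * ∑ g : G, σ.character g * ρ.character g⁻¹) := by
    rw [pci_eq_sum, map_smul, map_smul, map_sum, map_sum, smul_eq_mul, div_eq_mul_inv, mul_assoc]
    congr 2
    refine Finset.sum_congr rfl fun g _ => ?_
    rw [asAlgebraHom_single, map_smul, smul_eq_mul, mul_comm]
    rfl
  have hr : LinearMap.trace ℂ W (algebraMap ℂ (Module.End ℂ W) c) = c * Module.finrank ℂ W := by
    rw [Algebra.algebraMap_eq_smul_one, map_smul, LinearMap.trace_one, smul_eq_mul]
  rw [hl, hr, horth] at htr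
  constructor
  · rintro ⟨φ⟩
    rw [if_pos ⟨φ⟩, mul_one, φ.toLinearEquiv.finrank_eq] at htr
    have : c = 1 := by
      field_simp at htr
      exact htr.symm
    rw [hc, this, map_one]
  · intro h
    rw [if_neg h, mul_zero] at htr
    have : c = 0 := by simpa [hd] using htr.symm
    rw [hc, this, map_zero]

theorem asAlgebraHom_pci_self {G : Type*} [Group G] [Finite G] {V : Type*} [AddCommGroup V]
    [Module ℂ V] [FiniteDimensional ℂ V] (ρ : Representation ℂ G V) (hρ : ρ.IsIrreducible) :
    ρ.asAlgebraHom (pci ρ) = 1 :=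
  (asAlgebraHom_pci ρ hρ ρ hρ).1 ⟨.refl ρ⟩

theorem asAlgebraHom_eq_zero_of_equiv {G : Type*} [Group G] {V W : Type*} [AddCommGroup V]
    [Module ℂ V] [AddCommGroup W] [Module ℂ W] {ρ : Representation ℂ G V}
    {σ : Representation ℂ G W} (φ : Representation.Equiv ρ σ) (a : MonoidAlgebra ℂ G)
    (ha : ρ.asAlgebraHom a = 0) : σ.asAlgebraHom a = 0 := by
  have key : ∀ v, φ (ρ.asAlgebraHom a v) = σ.asAlgebraHom a (φ v) := by
    intro v
    clear ha
    induction a using MonoidAlgebra.induction_on with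
    | of g => simpa using LinearMap.congr_fun (φ.toIntertwiningMap.isIntertwining' g) v
    | add x y hx hy => simp only [map_add, LinearMap.add_apply, hx, hy]
    | smul r f hf => simp only [map_smul, LinearMap.smul_apply, hf]
  ext w
  obtain ⟨v, rfl⟩ := φ.toLinearEquiv.surjective w
  have := key v
  rw [ha] at this
  simpa using this.symm

theorem pci_idem {G : Type*} [Group G] [Finite G] {V : Type*} [AddCommGroup V] [Module ℂ V]
    [FiniteDimensional ℂ V] (ρ : Representation ℂ G V) (hρ : ρ.IsIrreducible) :
    IsIdempotentElem (pci ρ) := by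
  refine sub_eq_zero.1 (eq_zero_of_forall_irreducible _ fun U _ _ _ σ hσ => ?_)
  rw [map_sub, map_mul]
  by_cases h : Nonempty (Representation.Equiv ρ σ)
  · rw [(asAlgebraHom_pci ρ hρ σ hσ).1 h]; simp
  · rw [(asAlgebraHom_pci ρ hρ σ hσ).2 h]; simp

theorem pci_isPrimitiveCentralIdempotent {G : Type*} [Group G] [Finite G] {V : Type*}
    [AddCommGroup V] [Module ℂ V] [FiniteDimensional ℂ V] (ρ : Representation ℂ G V)
    (hρ : ρ.IsIrreducible) : IsPrimitiveCentralIdempotent (pci ρ) where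
  mem_center := pci_mem_center ρ
  idem := pci_idem ρ hρ
  ne_zero := by
    intro h0
    have h1 := asAlgebraHom_pci_self ρ hρ
    rw [h0, map_zero] at h1
    have := nontrivial_of_irreducible ρ hρ
    exact zero_ne_one h1
  minimal := by
    intro f hf hfi hfe
    obtain ⟨c, hc⟩ := exists_scalar ρ hρ f hf
    have hV := nontrivial_of_irreducible ρ hρ
    have hcc : c * c = c := by
      have := congrArg ρ.asAlgebraHom hfi.eq
      rw [map_mul, hc, ← map_mul] at this
      exact (algebraMap ℂ (Module.End ℂ V)).injective this
    have hz : ∀ a : MonoidAlgebra ℂ G, a * pci ρ = a → ρ.asAlgebraHom a = 0 → a = 0 := by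
      intro a ha h0
      refine eq_zero_of_forall_irreducible a fun U _ _ _ σ hσ => ?_
      by_cases h : Nonempty (Representation.Equiv ρ σ)
      · exact asAlgebraHom_eq_zero_of_equiv h.some a h0
      · rw [← ha, map_mul, (asAlgebraHom_pci ρ hρ σ hσ).2 h, mul_zero]
    by_cases h : c = 0
    · exact Or.inl (hz f hfe (by rw [hc, h, map_zero]))
    · have h1 : c = 1 := mul_right_cancel₀ h (by rw [hcc, one_mul])
      have hidem := pci_idem ρ hρ
      refine Or.inr (sub_eq_zero.1 (hz _ (by rw [sub_mul, hfe, hidem.eq]) ?_))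
      rw [map_sub, hc, h1, map_one, asAlgebraHom_pci_self ρ hρ, sub_self]

/-- Intrinsic characterization of `e_ρ`, for `ρ` irreducible: it is the unique primitive central
idempotent of `ℂ[G]` which acts as the identity in `ρ`. -/
theorem eq_pci_iff {G : Type*} [Group G] [Finite G] {V : Type*}
    [AddCommGroup V] [Module ℂ V] [FiniteDimensional ℂ V] (ρ : Representation ℂ G V)
    (hρ : ρ.IsIrreducible) (e : MonoidAlgebra ℂ G) :
    e = pci ρ ↔ IsPrimitiveCentralIdempotent e ∧ ρ.asAlgebraHom e = 1 := by
  have hV := nontrivial_of_irreducible ρ hρ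
  have hP := pci_isPrimitiveCentralIdempotent ρ hρ
  refine ⟨fun h => h ▸ ⟨hP, asAlgebraHom_pci_self ρ hρ⟩, fun ⟨he, h1⟩ => ?_⟩
  have hcomm : e * pci ρ = pci ρ * e := ((Set.mem_center_iff.1 he.mem_center).comm _).eq
  have hc : e * pci ρ ∈ Set.center (MonoidAlgebra ℂ G) :=
    Set.mul_mem_center he.mem_center hP.mem_center
  have hi : IsIdempotentElem (e * pci ρ) := by
    rw [IsIdempotentElem, mul_assoc, ← mul_assoc (pci ρ), ← hcomm, mul_assoc e (pci ρ),
      hP.idem.eq, ← mul_assoc, he.idem.eq]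
  have hne : e * pci ρ ≠ 0 := by
    intro h0
    have h2 := congrArg ρ.asAlgebraHom h0
    rw [map_mul, h1, asAlgebraHom_pci_self ρ hρ, map_zero, one_mul] at h2
    exact one_ne_zero h2
  have h3 := (he.minimal _ hc hi (by rw [mul_assoc, ← hcomm, ← mul_assoc, he.idem.eq])).resolve_left hne
  have h4 := (hP.minimal _ hc hi (by rw [mul_assoc, hP.idem.eq])).resolve_left hne
  rw [← h3, h4]

end GroupAlg

end

/-!
For an irreducible representation `η` of the normal subgroup `H` of prime index `p`, the conjugate
of `e_η` by `g⁻¹` is `e_{η^g}`, and `e_η` determines `η` up to equivalence. Two elements of `ℂ[G]`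
are compared through their actions in the irreducible representations of `G`.

If `e_η` is central, then `η` is equivalent to `η^x`. An equivalence can be rescaled so as to
satisfy the relations required of the image of `x`, and so gives an extension of `η` to `G`
(`exists_extension`, `exists_extension_of_equiv`). By Schur's lemma, the others arise from it by
multiplying the image of `x` by the `p`-th roots of unity (`exists_extensions`). Their characters
agree on `H` and sum to zero off `H`, whence `e_η` is the sum of their idempotents
(`incl_pci_eq_sum`). The class sum of a generator `y` of `G` modulo `H` acts in these extensions by
scalars which differ from each other by `p`-th roots of unity
(`character_relations_of_comp_subtype`). So its `p`-th power acts on all of them by one scalar `λ`,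
nonzero for some `y` because inequivalent representations have different characters
(`exists_character_ne_zero`). If `λ ≠ 0`, the scalars are the `p` distinct `p`-th roots of `λ`, and
the formula for `e_{ρ_i}` is a discrete Fourier inversion (`exists_perm_geom_sum`).

If `e_η` is not central, then its stabilizer in `G` is `H`, and the `η^{x^i}` for `i < p` are
pairwise inequivalent (`not_equiv_conjRep`). An irreducible representation `σ` of `G` whose
restriction to `H` contains `η` contains all of them, so it has dimension at least `p * dim W`. By
Frobenius reciprocity, it is a quotient of the representation induced from each of them, which has
dimension at most `p * dim W`. So it is equivalent to each induced representation, and it is the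
direct sum of the `η^{x^i}`, on which `∑ i, e_{η^{x^i}}` is the identity
(`equiv_ind_of_asAlgebraHom_ne_zero`). In all other irreducible representations this sum is zero.
-/

namespace GroupAlg

open Representation

/-! ### Irreducible representations and intertwining maps -/

theorem exists_eq_smul_one_of_commute {K : Type*} [Group K] {W : Type*} [AddCommGroup W]
    [Module ℂ W] [FiniteDimensional ℂ W] {η : Representation ℂ K W} (hη : η.IsIrreducible)
    (A : Module.End ℂ W) (hA : ∀ h, A * η h = η h * A) : ∃ c : ℂ, A = c • 1 := by
  obtain ⟨c, hc⟩ := (IsIrreducible.algebraMap_intertwiningMap_bijective_of_isAlgClosed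
    (ρ := η)).2 ⟨A, hA⟩
  refine ⟨c, ?_⟩
  have := congrArg IntertwiningMap.toLinearMap hc
  rw [show A = (⟨A, hA⟩ : IntertwiningMap η η).toLinearMap from rfl, ← this]
  rfl

theorem isIrreducible_of_comp {K L : Type*} [Group K] [Group L] {W : Type*} [AddCommGroup W]
    [Module ℂ W] (ρ : Representation ℂ L W) (φ : K →* L)
    (h : IsIrreducible (MonoidHom.comp ρ φ)) : ρ.IsIrreducible := by
  let r : Subrepresentation ρ → Subrepresentation (MonoidHom.comp ρ φ : Representation ℂ K W) :=
    fun S => ⟨S.toSubmodule, fun g _ hv => S.apply_mem_toSubmodule (φ g) hv⟩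
  have := nontrivial_of_irreducible _ h
  have hsub : ∀ S : Subrepresentation ρ, S.toSubmodule = ⊥ ∨ S.toSubmodule = ⊤ := fun S =>
    (h.eq_bot_or_eq_top (r S)).imp (congrArg Subrepresentation.toSubmodule)
      (congrArg Subrepresentation.toSubmodule)
  exact
    { exists_pair_ne := ⟨⊥, ⊤, fun e => bot_ne_top
        (congrArg Subrepresentation.toSubmodule e : (⊥ : Submodule ℂ W) = ⊤)⟩
      eq_bot_or_eq_top := fun S => (hsub S).imp
        (fun e => Subrepresentation.toSubmodule_injective e)
        (fun e => Subrepresentation.toSubmodule_injective e) }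

theorem conjRep_isIrreducible {G : Type*} [Group G] {H : Subgroup G} [H.Normal] {W : Type*}
    [AddCommGroup W] [Module ℂ W] {η : Representation ℂ H W} (hη : η.IsIrreducible) (g : G) :
    (conjRep η g).IsIrreducible := by
  refine isIrreducible_of_comp _ (MulAut.conjNormal g⁻¹).toMonoidHom ?_
  have : MonoidHom.comp (conjRep η g) (MulAut.conjNormal g⁻¹).toMonoidHom = η := by
    ext1 h
    refine congrArg η (Subtype.ext ?_)
    simp
  rwa [this]

/-- If `e_η` does not annihilate a representation, then `η` maps nontrivially to it: summing the
translates of a map `w ↦ φ w • v` over the group gives an intertwining map, and up to a scalar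
`e_η v` is the sum of the values of these maps on a basis of `W`, for `φ` in the dual basis. -/
theorem exists_intertwiningMap_ne_zero {K : Type*} [Group K] [Finite K] {V W : Type*}
    [AddCommGroup V] [Module ℂ V] [AddCommGroup W] [Module ℂ W] [FiniteDimensional ℂ W]
    (η : Representation ℂ K W) (τ : Representation ℂ K V) (h : τ.asAlgebraHom (pci η) ≠ 0) :
    ∃ f : IntertwiningMap η τ, f ≠ 0 := by
  have := Fintype.ofFinite K
  contrapose! h
  -- the sum over the group of the translates of a linear map
  let avg : (W →ₗ[ℂ] V) → IntertwiningMap η τ := fun A =>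
    ⟨∑ k : K, τ k ∘ₗ A ∘ₗ η k⁻¹, fun g => by
      ext w
      simp only [LinearMap.comp_apply, LinearMap.sum_apply, map_sum]
      refine Fintype.sum_equiv (Equiv.mulLeft g⁻¹) _ _ fun k => ?_
      simp⟩
  let b := Module.finBasis ℂ W
  rw [pci_eq_sum, map_smul, map_sum]
  refine smul_eq_zero_of_right _ ?_
  ext v
  have key : ∀ i, ∑ k : K, (b.coord i (η k⁻¹ (b i))) • τ k v = 0 := fun i => by
    have := DFunLike.congr_fun (h (avg ((b.coord i).smulRight v))) (b i)
    simpa [avg, ← IntertwiningMap.toLinearMap_apply] using this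
  have hs : ∑ i, ∑ k : K, (b.coord i (η k⁻¹ (b i))) • τ k v = 0 :=
    Finset.sum_eq_zero fun i _ => key i
  rw [Finset.sum_comm] at hs
  rw [LinearMap.sum_apply, LinearMap.zero_apply, ← hs]
  refine Finset.sum_congr rfl fun k _ => ?_
  rw [asAlgebraHom_single, LinearMap.smul_apply, ← Finset.sum_smul, character,
    LinearMap.trace_eq_matrix_trace ℂ b]
  simp [Matrix.trace, LinearMap.toMatrix_apply]

theorem asAlgebraHom_pci_ne_zero_iff {K : Type*} [Group K] [Finite K] {V W : Type*}
    [AddCommGroup V] [Module ℂ V] [FiniteDimensional ℂ V] [AddCommGroup W] [Module ℂ W]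
    [FiniteDimensional ℂ W] {ρ : Representation ℂ K V} (hρ : ρ.IsIrreducible)
    {σ : Representation ℂ K W} (hσ : σ.IsIrreducible) :
    σ.asAlgebraHom (pci ρ) ≠ 0 ↔ Nonempty (Representation.Equiv ρ σ) := by
  have := nontrivial_of_irreducible σ hσ
  refine ⟨fun h => not_not.1 fun hn => h ((asAlgebraHom_pci ρ hρ σ hσ).2 hn), fun h => ?_⟩
  rw [(asAlgebraHom_pci ρ hρ σ hσ).1 h]
  exact one_ne_zero

/-- An element which acts in `ρ` as a scalar acts by the same scalar on the ideal of `e_ρ`. -/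
theorem mul_pci_eq_smul {K : Type*} [Group K] [Finite K] {V : Type*}
    [AddCommGroup V] [Module ℂ V] [FiniteDimensional ℂ V] {ρ : Representation ℂ K V}
    (hρ : ρ.IsIrreducible) {a : MonoidAlgebra ℂ K} {c : ℂ} (ha : ρ.asAlgebraHom a = c • 1) :
    a * pci ρ = c • pci ρ := by
  refine sub_eq_zero.1 (eq_zero_of_forall_irreducible _ fun U _ _ _ σ hσ => ?_)
  by_cases h : Nonempty (Representation.Equiv ρ σ)
  · refine asAlgebraHom_eq_zero_of_equiv h.some _ ?_
    rw [map_sub, map_mul, map_smul, ha, asAlgebraHom_pci_self ρ hρ, mul_one, sub_self]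
  · rw [map_sub, map_mul, map_smul, (asAlgebraHom_pci ρ hρ σ hσ).2 h, mul_zero, smul_zero,
      sub_zero]

theorem pci_eq_of_equiv {K : Type*} [Group K] {V W : Type*}
    [AddCommGroup V] [Module ℂ V] [AddCommGroup W] [Module ℂ W] {ρ : Representation ℂ K V}
    {σ : Representation ℂ K W} (e : Representation.Equiv ρ σ) : pci ρ = pci σ := by
  have hc : ∀ g, ρ.character g = σ.character g := fun g => by
    rw [character, character, ← LinearMap.trace_conj' (ρ g) e.toLinearEquiv]
    exact congrArg _ (Equiv.conj_apply_self g e)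
  simp only [pci, hc, e.toLinearEquiv.finrank_eq]

/-! ### The group algebra of a normal subgroup -/

theorem incl_injective {G : Type*} [Group G] (H : Subgroup G) : Function.Injective (incl H) :=
  MonoidAlgebra.mapDomain_injective H.subtype_injective

theorem incl_single {G : Type*} [Group G] (H : Subgroup G) (h : H) (c : ℂ) :
    incl H (MonoidAlgebra.single h c) = MonoidAlgebra.single (h : G) c :=
  MonoidAlgebra.mapDomain_single

theorem incl_smul {G : Type*} [Group G] (H : Subgroup G) (c : ℂ) (a : MonoidAlgebra ℂ H) :
    incl H (c • a) = c • incl H a :=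
  MonoidAlgebra.mapDomain_smul ..

theorem asAlgebraHom_incl {G : Type*} [Group G] (H : Subgroup G) {V : Type*} [AddCommGroup V]
    [Module ℂ V] (σ : Representation ℂ G V) (a : MonoidAlgebra ℂ H) :
    σ.asAlgebraHom (incl H a) = asAlgebraHom (σ.comp H.subtype : Representation ℂ H V) a := by
  induction a using MonoidAlgebra.induction_on with
  | of h => simp [incl_single]
  | add x y hx hy => simp only [map_add, hx, hy]
  | smul r f hf => rw [incl_smul, map_smul, map_smul, hf]

theorem incl_pci_conjRep {G : Type*} [Group G] [Finite G] {H : Subgroup G} [H.Normal] {W : Type*}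
    [AddCommGroup W] [Module ℂ W] (η : Representation ℂ H W) (g : G) :
    incl H (pci (conjRep η g)) =
      MonoidAlgebra.single g⁻¹ 1 * incl H (pci η) * MonoidAlgebra.single g 1 := by
  have := Fintype.ofFinite H
  rw [pci_eq_sum, pci_eq_sum, incl_smul, incl_smul, map_sum, map_sum, mul_smul_comm,
    smul_mul_assoc, Finset.mul_sum, Finset.sum_mul]
  congr 1
  refine Fintype.sum_equiv (MulAut.conjNormal g).toEquiv _ _ fun h => ?_
  simp [incl_single, MonoidAlgebra.single_mul_single, mul_assoc, conjRep, character]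

/-! ### Extending a representation along a cyclic quotient -/

theorem exists_eq_mul_zpow {G : Type*} [Group G] {H : Subgroup G} [H.Normal] {x : G}
    (hx : Subgroup.zpowers (x : G ⧸ H) = ⊤) (g : G) : ∃ (h : H) (k : ℤ), g = h * x ^ k := by
  obtain ⟨k, hk⟩ := Subgroup.mem_zpowers_iff.1 (hx ▸ Subgroup.mem_top (g : G ⧸ H))
  refine ⟨⟨g * (x ^ k)⁻¹, ?_⟩, k, by simp⟩
  rw [← QuotientGroup.eq_one_iff, QuotientGroup.mk_mul, QuotientGroup.mk_inv,
    QuotientGroup.mk_zpow, hk, mul_inv_cancel]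

theorem zpow_mem_iff_dvd {G : Type*} [Group G] {H : Subgroup G} [H.Normal] {x : G}
    (hx : Subgroup.zpowers (x : G ⧸ H) = ⊤) (k : ℤ) : x ^ k ∈ H ↔ (H.index : ℤ) ∣ k := by
  rw [← QuotientGroup.eq_one_iff, QuotientGroup.mk_zpow, ← orderOf_dvd_iff_zpow_eq_one,
    ← Nat.card_zpowers, hx, Subgroup.card_top, Subgroup.index]

theorem pow_index_mem {G : Type*} [Group G] {H : Subgroup G} [H.Normal] {x : G}
    (hx : Subgroup.zpowers (x : G ⧸ H) = ⊤) : x ^ H.index ∈ H := by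
  exact_mod_cast (zpow_mem_iff_dvd hx H.index).2 dvd_rfl

theorem zpowers_mk_eq_top {G : Type*} [Group G] {H : Subgroup G} [H.Normal] {p : ℕ}
    (hp : p.Prime) (hindex : H.index = p) {y : G} (hy : y ∉ H) :
    Subgroup.zpowers (y : G ⧸ H) = ⊤ := by
  have := Fact.mk hp
  exact zpowers_eq_top_of_prime_card (p := p) hindex
    fun h => hy ((QuotientGroup.eq_one_iff y).1 h)

/-- Suppose that `x` generates `G` modulo `H` and that `T` satisfies the relations which the
image of `x` has to satisfy: it conjugates `η` to `η^x`, and its power of exponent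
`n = |G : H|` is `η (x ^ n)`. Then `η` extends to `G` by `x ↦ T`: the map
`(h, k) ↦ η h * T ^ k` is a homomorphism on the semidirect product `H ⋊ ℤ`, and it factors
through the surjection `(h, k) ↦ h * x ^ k` onto `G`. -/
theorem exists_extension {G : Type*} [Group G] {H : Subgroup G} [H.Normal] {x : G}
    (hx : Subgroup.zpowers (x : G ⧸ H) = ⊤) {W : Type*} [AddCommGroup W] [Module ℂ W]
    (η : Representation ℂ H W) (T : (Module.End ℂ W)ˣ)
    (hT : ∀ h, ↑T * η h = conjRep η x h * ↑T)
    (hTn : (T : Module.End ℂ W) ^ H.index = η ⟨x ^ H.index, pow_index_mem hx⟩) :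
    ∃ ρ : Representation ℂ G W, ρ.comp H.subtype = η ∧ ρ x = T := by
  let u : H →* (Module.End ℂ W)ˣ := η.toHomUnits
  have hu : ∀ h, (u h : Module.End ℂ W) = η h := fun h => rfl
  let φ : Multiplicative ℤ →* MulAut H := zpowersHom _ (MulAut.conjNormal x)
  have hconj : ∀ (k : ℤ) (h : H), MulAut.conj (T ^ k) (u h) = u (MulAut.conjNormal (x ^ k) h) := by
    have h1 : ∀ h : H, T * u h * T⁻¹ = u (MulAut.conjNormal x h) := fun h => by
      rw [mul_inv_eq_iff_eq_mul]
      exact Units.ext (hT h)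
    have h2 : ∀ h : H, T⁻¹ * u h * T = u (MulAut.conjNormal x⁻¹ h) := fun h => by
      have := h1 (MulAut.conjNormal x⁻¹ h)
      rw [← MulAut.mul_apply, ← map_mul, mul_inv_cancel, map_one, MulAut.one_apply] at this
      rw [← this]
      simp [mul_assoc]
    intro k
    induction k using Int.induction_on with
    | zero => simp
    | succ k ih =>
      intro h
      rw [zpow_add_one, zpow_add_one, map_mul, map_mul, MulAut.mul_apply, MulAut.mul_apply, ← ih,
        ← h1, MulAut.conj_apply T]
    | pred k ih =>
      intro h
      rw [zpow_sub_one, zpow_sub_one, map_mul, map_mul, MulAut.mul_apply, MulAut.mul_apply, ← ih,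
        ← h2, MulAut.conj_apply T⁻¹, inv_inv]
  let π : H ⋊[φ] Multiplicative ℤ →* G := SemidirectProduct.lift H.subtype (zpowersHom G x)
    fun k => by ext h; simp [φ, ← map_zpow]
  let F : H ⋊[φ] Multiplicative ℤ →* (Module.End ℂ W)ˣ :=
    SemidirectProduct.lift u (zpowersHom _ T) fun k => by
      ext1 h
      simpa [φ, ← map_zpow] using (hconj k.toAdd h).symm
  have hπ : Function.Surjective π := fun g => by
    obtain ⟨h, k, rfl⟩ := exists_eq_mul_zpow hx g
    exact ⟨⟨h, Multiplicative.ofAdd k⟩, by simp [π, SemidirectProduct.lift]⟩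
  have hker : π.ker ≤ F.ker := by
    rintro ⟨h, k⟩ hk
    have hk' : (h : G) * x ^ k.toAdd = 1 := hk
    have hmem : x ^ k.toAdd ∈ H := by
      rw [eq_inv_of_mul_eq_one_right hk']
      exact H.inv_mem h.2
    obtain ⟨m, hm⟩ := (zpow_mem_iff_dvd hx _).1 hmem
    have hTk : T ^ k.toAdd = u ⟨x ^ k.toAdd, hmem⟩ := by
      have h1 : T ^ H.index = u ⟨x ^ H.index, pow_index_mem hx⟩ :=
        Units.ext (by rw [Units.val_pow_eq_pow_val, hTn, hu])
      have h2 : (⟨x ^ k.toAdd, hmem⟩ : H) = ⟨x ^ H.index, pow_index_mem hx⟩ ^ m :=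
        Subtype.ext (by simp [hm, zpow_mul])
      rw [h2, map_zpow, ← h1, hm, zpow_mul, zpow_natCast]
    change u h * T ^ k.toAdd = 1
    rw [hTk, ← map_mul, show h * ⟨x ^ k.toAdd, hmem⟩ = 1 from Subtype.ext hk', map_one]
  let ρ : G →* (Module.End ℂ W)ˣ := π.liftOfSurjective hπ ⟨F, hker⟩
  have hρ : ∀ a, ρ (π a) = F a := fun a => π.liftOfRightInverse_comp_apply _ _ ⟨F, hker⟩ a
  refine ⟨(Units.coeHom _).comp ρ, ?_, ?_⟩
  · ext1 h
    have := hρ (SemidirectProduct.inl h)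
    simp only [π, F, SemidirectProduct.lift_inl] at this
    exact congrArg Units.val this
  · have := hρ (SemidirectProduct.inr (Multiplicative.ofAdd 1))
    simp only [π, F, SemidirectProduct.lift_inr, zpowersHom_apply, toAdd_ofAdd, zpow_one] at this
    exact congrArg Units.val this

/-- A representation is determined by its restriction to `H` and the image of `x`. -/
theorem ext_of_comp_subtype {G : Type*} [Group G] {H : Subgroup G} [H.Normal] {x : G}
    (hx : Subgroup.zpowers (x : G ⧸ H) = ⊤) {W : Type*} [AddCommGroup W] [Module ℂ W]
    {ρ σ : Representation ℂ G W} (hres : ρ.comp H.subtype = σ.comp H.subtype)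
    (h : ρ x = σ x) : ρ = σ := by
  have hu : ρ.toHomUnits x = σ.toHomUnits x := Units.ext h
  ext1 g
  obtain ⟨h, k, rfl⟩ := exists_eq_mul_zpow hx g
  have h1 : ρ h = σ h := DFunLike.congr_fun hres h
  have h2 : ρ (x ^ k) = σ (x ^ k) := by
    have : ρ.toHomUnits (x ^ k) = σ.toHomUnits (x ^ k) := by rw [map_zpow, map_zpow, hu]
    exact congrArg Units.val this
  rw [map_mul, map_mul, h1, h2]

/-- Two extensions of an irreducible representation of `H` differ by a scalar on each coset. -/
theorem exists_smul_eq_of_comp_subtype {G : Type*} [Group G] {H : Subgroup G} [H.Normal]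
    {W : Type*} [AddCommGroup W] [Module ℂ W] [FiniteDimensional ℂ W]
    {η : Representation ℂ H W} (hη : η.IsIrreducible) {ρ σ : Representation ℂ G W}
    (hρ : ρ.comp H.subtype = η) (hσ : σ.comp H.subtype = η) (g : G) :
    ∃ c : ℂ, ρ g = c • σ g := by
  have hh : ∀ h : H, ρ h = η h ∧ σ h = η h := fun h =>
    ⟨DFunLike.congr_fun hρ h, DFunLike.congr_fun hσ h⟩
  obtain ⟨c, hc⟩ := exists_eq_smul_one_of_commute hη (ρ g * σ g⁻¹) fun h => by
    have h1 := (hh h).2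
    have h2 := (hh (MulAut.conjNormal g⁻¹ h))
    have h3 : g⁻¹ * h = (MulAut.conjNormal g⁻¹ h : H) * g⁻¹ := by simp
    have h4 : g * (MulAut.conjNormal g⁻¹ h : H) = h * g := by simp [mul_assoc]
    rw [← h1, mul_assoc, ← map_mul, h3, map_mul, h2.2, ← h2.1, ← mul_assoc, ← map_mul, h4,
      map_mul, (hh h).1, ← h1, mul_assoc]
  refine ⟨c, ?_⟩
  rw [← one_mul (σ g), ← smul_mul_assoc, ← hc, mul_assoc, ← map_mul]
  simp

/-! ### The extensions of an invariant representation -/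

theorem conjRep_apply {G : Type*} [Group G] {H : Subgroup G} [H.Normal] {W : Type*}
    [AddCommGroup W] [Module ℂ W] (η : Representation ℂ H W) (g : G) (h : H) :
    conjRep η g h = η (MulAut.conjNormal g h) := rfl

/-- If `e_η` commutes with `g`, then `e_η = e_{η^g}`, and so `η` is equivalent to `η^g`. -/
theorem nonempty_equiv_conjRep {G : Type*} [Group G] [Finite G] {H : Subgroup G} [H.Normal]
    {W : Type*} [AddCommGroup W] [Module ℂ W] [FiniteDimensional ℂ W]
    {η : Representation ℂ H W} (hη : η.IsIrreducible) {g : G}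
    (hg : Commute (incl H (pci η)) (MonoidAlgebra.single g 1)) :
    Nonempty (Representation.Equiv η (conjRep η g)) := by
  have h1 : pci (conjRep η g) = pci η := incl_injective H (by
    rw [incl_pci_conjRep, mul_assoc, hg.eq, ← mul_assoc, MonoidAlgebra.single_mul_single]
    simp [← MonoidAlgebra.one_def])
  rw [← asAlgebraHom_pci_ne_zero_iff hη (conjRep_isIrreducible hη g), ← h1,
    asAlgebraHom_pci_self _ (conjRep_isIrreducible hη g)]
  have := nontrivial_of_irreducible η hη
  exact one_ne_zero

/-- If `T` carries `η` to `η^x`, then `T ^ n` and `η (x ^ n)`, for `n = |G : H|`, both carry `η` to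
`η^(x ^ n)`, so they differ by a scalar by Schur's lemma. Rescaling `T` removes it. -/
theorem exists_extension_of_equiv {G : Type*} [Group G] {H : Subgroup G} [H.Normal] {x : G}
    (hx : Subgroup.zpowers (x : G ⧸ H) = ⊤) (hn : H.index ≠ 0) {W : Type*} [AddCommGroup W]
    [Module ℂ W] [FiniteDimensional ℂ W] {η : Representation ℂ H W} (hη : η.IsIrreducible)
    (e : Representation.Equiv η (conjRep η x)) :
    ∃ ρ : Representation ℂ G W, ρ.comp H.subtype = η := by
  have := nontrivial_of_irreducible η hη
  let T := LinearMap.GeneralLinearGroup.ofLinearEquiv e.toLinearEquiv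
  have hT : ∀ h, (T : Module.End ℂ W) * η h = conjRep η x h * T :=
    e.toIntertwiningMap.isIntertwining'
  have hTk : ∀ (k : ℕ) h, (T : Module.End ℂ W) ^ k * η h =
      conjRep η (x ^ k) h * (T : Module.End ℂ W) ^ k := by
    intro k
    induction k with
    | zero => simp [conjRep_apply]
    | succ k ih =>
      intro h
      rw [pow_succ, mul_assoc, hT, conjRep_apply, ← mul_assoc, ih, mul_assoc, conjRep_apply,
        conjRep_apply, pow_succ x, map_mul MulAut.conjNormal, MulAut.mul_apply]
  let b : H := ⟨x ^ H.index, pow_index_mem hx⟩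
  have hb : ∀ h, conjRep η (x ^ H.index) h = η b * η h * η b⁻¹ := fun h => by
    rw [← map_mul, ← map_mul, conjRep_apply]
    exact congrArg η (Subtype.ext (by rw [MulAut.conjNormal_apply]; rfl))
  have hbb : η b⁻¹ * η b = 1 := by rw [← map_mul, inv_mul_cancel, map_one]
  have hbb' : η b * η b⁻¹ = 1 := by rw [← map_mul, mul_inv_cancel, map_one]
  obtain ⟨c, hc⟩ := exists_eq_smul_one_of_commute hη (η b⁻¹ * (T : Module.End ℂ W) ^ H.index)
    fun h => by
      rw [mul_assoc, hTk, hb, mul_assoc (η b), mul_assoc (η b), ← mul_assoc, hbb, one_mul,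
        mul_assoc]
  have hcT : (T : Module.End ℂ W) ^ H.index = c • η b := by
    rw [← one_mul (_ ^ _), ← hbb', mul_assoc, hc, mul_smul_comm, mul_one]
  have hc0 : c ≠ 0 := by
    rintro rfl
    rw [zero_smul] at hcT
    exact (T ^ H.index).ne_zero (by rw [Units.val_pow_eq_pow_val, hcT])
  -- rescaling `T` by an `n`-th root of `c⁻¹` turns `T ^ n = c • η (x ^ n)` into `T ^ n = η (x ^ n)`
  obtain ⟨s, hs⟩ := IsAlgClosed.exists_pow_nat_eq c⁻¹ hn.bot_lt
  have hs0 : s ≠ 0 := by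
    rintro rfl
    rw [zero_pow hn] at hs
    exact inv_ne_zero hc0 hs.symm
  obtain ⟨ρ, hρ, -⟩ := exists_extension hx η (Units.mk0 s hs0 • T)
    (fun h => by simp [Units.smul_def, hT]) (by
      rw [Units.val_smul, smul_pow, hcT, Units.smul_def, Units.val_pow_eq_pow_val,
        Units.val_mk0, hs, smul_smul, inv_mul_cancel₀ hc0, one_smul])
  exact ⟨ρ, hρ⟩

/-- An equivalence of two extensions of `η` commutes with `η`, so it is a scalar, and the extensions
are equal. -/
theorem eq_of_equiv_of_comp_subtype {G : Type*} [Group G] {H : Subgroup G} {W : Type*}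
    [AddCommGroup W] [Module ℂ W] [FiniteDimensional ℂ W] {η : Representation ℂ H W}
    (hη : η.IsIrreducible) {ρ σ : Representation ℂ G W} (hρ : ρ.comp H.subtype = η)
    (hσ : σ.comp H.subtype = η) (e : Representation.Equiv ρ σ) : ρ = σ := by
  have := nontrivial_of_irreducible η hη
  have he : ∀ g, e.toLinearMap * ρ g = σ g * e.toLinearMap := e.toIntertwiningMap.isIntertwining'
  obtain ⟨c, hc⟩ := exists_eq_smul_one_of_commute hη e.toLinearMap fun h => by
    have h1 : ρ h = η h := DFunLike.congr_fun hρ h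
    have h2 : σ h = η h := DFunLike.congr_fun hσ h
    have h3 := he h
    rwa [h1, h2] at h3
  have hc0 : c ≠ 0 := by
    rintro rfl
    obtain ⟨w, hw⟩ := exists_ne (0 : W)
    refine hw (e.toLinearEquiv.injective ?_)
    have := DFunLike.congr_fun hc w
    simpa using this
  ext1 g
  have h1 := he g
  rw [hc, smul_mul_assoc, one_mul, mul_smul_comm, mul_one] at h1
  exact smul_right_injective _ hc0 h1

/-- The ratio of two extensions of `η` at an element `g` is a root of unity of order dividing the
index of `H`, because the extensions agree at the power of `g` lying in `H`. -/
theorem pow_index_eq_one_of_eq_smul {G : Type*} [Group G] {H : Subgroup G} [H.Normal] {W : Type*}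
    [AddCommGroup W] [Module ℂ W] [Nontrivial W] {ρ σ : Representation ℂ G W}
    (h : ρ.comp H.subtype = σ.comp H.subtype) {g : G} {c : ℂ}
    (hg : Subgroup.zpowers (g : G ⧸ H) = ⊤) (hc : ρ g = c • σ g) : c ^ H.index = 1 := by
  have h1 : ρ (g ^ H.index) = σ (g ^ H.index) :=
    DFunLike.congr_fun h (⟨g ^ H.index, pow_index_mem hg⟩ : H)
  rw [map_pow, hc, smul_pow, ← map_pow] at h1
  have h0 : σ (g ^ H.index) ≠ 0 := (σ.toHomUnits (g ^ H.index)).ne_zero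
  exact smul_left_injective ℂ h0 (by simpa using h1)

/-- An irreducible representation of `H` which has an extension `ρ₀` to `G` has exactly `p`
extensions: one with `x ↦ ζ ^ i • ρ₀ x` for each `i < p`, where `ζ` is a primitive `p`-th root of
unity. Their characters sum to zero off `H`, because the powers of a nontrivial `p`-th root of
unity do. -/
theorem exists_extensions {G : Type*} [Group G] {H : Subgroup G} [H.Normal] {p : ℕ}
    (hp : p.Prime) (hindex : H.index = p) {x : G} (hx : Subgroup.zpowers (x : G ⧸ H) = ⊤)
    {W : Type*} [AddCommGroup W] [Module ℂ W] [FiniteDimensional ℂ W]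
    {η : Representation ℂ H W} (hη : η.IsIrreducible) (ρ₀ : Representation ℂ G W)
    (hρ₀ : ρ₀.comp H.subtype = η) :
    ∃ ρ : Fin p → Representation ℂ G W,
      (∀ i, (ρ i).comp H.subtype = η) ∧ Function.Injective ρ ∧
      (∀ σ : Representation ℂ G W, σ.comp H.subtype = η → ∃ i, σ = ρ i) ∧
      ∀ g ∉ H, ∑ i, (ρ i).character g = 0 := by
  have := nontrivial_of_irreducible η hη
  have := NeZero.mk hp.ne_zero
  obtain ⟨ζ, hζ⟩ : ∃ ζ : ℂ, IsPrimitiveRoot ζ p := ⟨_, Complex.isPrimitiveRoot_exp p hp.ne_zero⟩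
  let z : ℂˣ := Units.mk0 ζ (hζ.ne_zero hp.ne_zero)
  have hzp' : ζ ^ H.index = 1 := hindex ▸ hζ.pow_eq_one
  have hsurj : ∀ i : Fin p, ∃ ρ : Representation ℂ G W,
      ρ.comp H.subtype = η ∧ ρ x = ζ ^ (i : ℕ) • ρ₀ x := fun i => by
    refine exists_extension hx η (z ^ (i : ℕ) • ρ₀.toHomUnits x) (fun h => ?_) ?_
    · have h1 : ρ₀ x * η h = conjRep η x h * ρ₀ x := by
        rw [← hρ₀]
        simp [conjRep, ← map_mul]
      change ζ ^ (i : ℕ) • ρ₀ x * _ = _ * ζ ^ (i : ℕ) • ρ₀ x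
      rw [smul_mul_assoc, mul_smul_comm, h1]
    · change (ζ ^ (i : ℕ) • ρ₀ x) ^ _ = _
      rw [smul_pow, ← pow_mul, mul_comm, pow_mul, hzp', one_pow, one_smul,
        ← map_pow, ← hρ₀]
      rfl
  choose ρ hρ hρx using hsurj
  have hx0 : ρ₀ x ≠ 0 := (ρ₀.toHomUnits x).ne_zero
  refine ⟨ρ, hρ, fun i j hij => ?_, fun σ hσ => ?_, fun g hg => ?_⟩
  · have h1 : ζ ^ (i : ℕ) • ρ₀ x = ζ ^ (j : ℕ) • ρ₀ x := by rw [← hρx, ← hρx, hij]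
    exact Fin.ext (hζ.pow_inj i.2 j.2 (smul_left_injective ℂ hx0 h1))
  · obtain ⟨c, hc⟩ := exists_smul_eq_of_comp_subtype hη hσ hρ₀ x
    have hcp := pow_index_eq_one_of_eq_smul (hσ.trans hρ₀.symm) hx hc
    rw [hindex] at hcp
    obtain ⟨i, hi, rfl⟩ := hζ.eq_pow_of_pow_eq_one hcp
    exact ⟨⟨i, hi⟩, ext_of_comp_subtype hx (hσ.trans (hρ _).symm) (by rw [hc, hρx])⟩
  · obtain ⟨h, k, rfl⟩ := exists_eq_mul_zpow hx g
    have hk : ¬ (p : ℤ) ∣ k := fun hk =>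
      hg (H.mul_mem h.2 ((zpow_mem_iff_dvd hx k).2 (hindex ▸ hk)))
    have hval : ∀ i, ρ i (h * x ^ k) = (ζ ^ k) ^ (i : ℕ) • ρ₀ (h * x ^ k) := fun i => by
      let A := Units.map (algebraMap ℂ (Module.End ℂ W)).toMonoidHom
      have h1 : (ρ i).toHomUnits x = A (z ^ (i : ℕ)) * ρ₀.toHomUnits x :=
        Units.ext ((hρx i).trans (Algebra.smul_def ..))
      have h2 : (ρ i).toHomUnits (x ^ k) = A ((z ^ k) ^ (i : ℕ)) * ρ₀.toHomUnits (x ^ k) := by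
        have hcomm : Commute (A (z ^ (i : ℕ))) (ρ₀.toHomUnits x) :=
          Units.ext (Algebra.commutes _ _)
        rw [map_zpow, map_zpow, h1, hcomm.mul_zpow, ← map_zpow, ← zpow_natCast, ← zpow_natCast,
          ← zpow_mul, ← zpow_mul, mul_comm (i : ℤ)]
      have h3 : ρ i (x ^ k) = (ζ ^ k) ^ (i : ℕ) • ρ₀ (x ^ k) := by
        refine (congrArg Units.val h2).trans ?_
        rw [← Units.val_mk0 (hζ.ne_zero hp.ne_zero), ← Units.val_zpow_eq_zpow_val,
          ← Units.val_pow_eq_pow_val, Algebra.smul_def]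
        rfl
      have h4 : ρ i h = ρ₀ h := DFunLike.congr_fun ((hρ i).trans hρ₀.symm) h
      rw [map_mul, map_mul, h3, h4, mul_smul_comm]
    have hgeom : ∑ i ∈ Finset.range p, (ζ ^ k) ^ i = 0 := by
      refine IsPrimitiveRoot.geom_sum_eq_zero (hζ.zpow_of_gcd_eq_one k ?_) hp.one_lt
      rw [← Int.isCoprime_iff_gcd_eq_one]
      exact ((Nat.prime_iff_prime_int.1 hp).coprime_iff_not_dvd.2 hk).symm
    simp only [character, hval, map_smul]
    rw [← Finset.sum_smul, Fin.sum_univ_eq_sum_range (fun i => (ζ ^ k) ^ i), hgeom, zero_smul]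

/-- If the characters of all `|G : H|` extensions of `η` sum to zero off `H`, then the `e_ρ` of
these extensions `ρ` sum to `e_η`: the two sides agree coefficient by coefficient. -/
theorem incl_pci_eq_sum {G : Type*} [Group G] [Finite G] {H : Subgroup G} {W : Type*}
    [AddCommGroup W] [Module ℂ W] {η : Representation ℂ H W} {n : ℕ} (hn : H.index = n)
    {ρ : Fin n → Representation ℂ G W} (hρ : ∀ i, (ρ i).comp H.subtype = η)
    (h0 : ∀ g ∉ H, ∑ i, (ρ i).character g = 0) : incl H (pci η) = ∑ i, pci (ρ i) := by
  have := Fintype.ofFinite G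
  have := Fintype.ofFinite H
  have hcard : (Nat.card G : ℂ) = Nat.card H * n := by
    rw [← H.card_mul_index, hn, Nat.cast_mul]
  have hn0 : (n : ℂ) ≠ 0 := by
    rw [← hn]
    exact_mod_cast H.index_ne_zero_of_finite
  have hH0 : (Nat.card H : ℂ) ≠ 0 := by simp
  have hsingle : ∀ (g : G) (f : Fin n → ℂ),
      MonoidAlgebra.single g (∑ i, f i) = ∑ i, MonoidAlgebra.single g (f i) := fun g f =>
    map_sum (MonoidAlgebra.singleAddHom g) f Finset.univ
  simp only [pci_eq_sum]
  rw [← Finset.smul_sum, Finset.sum_comm, incl_smul, map_sum, hcard, ← div_div,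
    div_eq_mul_inv _ (n : ℂ), mul_smul, Finset.smul_sum (r := (n : ℂ)⁻¹)]
  congr 1
  refine Fintype.sum_of_injective H.subtype H.subtype_injective _ _ (fun g hg => ?_) fun h => ?_
  · have hg' : g⁻¹ ∉ H := fun h => hg ⟨⟨g, by simpa using h⟩, rfl⟩
    rw [← hsingle, h0 _ hg', MonoidAlgebra.single_zero, smul_zero]
  · have hχ : ∀ i, (ρ i).character (H.subtype h)⁻¹ = η.character h⁻¹ := fun i => by
      rw [← hρ i]
      rfl
    simp only [hχ]
    rw [incl_single, Finset.sum_const, Finset.card_univ, Fintype.card_fin,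
      ← Nat.cast_smul_eq_nsmul ℂ, smul_smul, inv_mul_cancel₀ hn0, one_smul]
    rfl

/-! ### Class sums and the central case -/

theorem asAlgebraHom_classSum {G : Type*} [Group G] [Finite G] {V : Type*} [AddCommGroup V]
    [Module ℂ V] (ρ : Representation ℂ G V) (y : G) :
    ρ.asAlgebraHom (classSum y) = ∑ g ∈ (Set.toFinite (conjugatesOf y)).toFinset, ρ g := by
  rw [classSum, finsum_mem_eq_finite_toFinset_sum _ (Set.toFinite _), map_sum]
  simp

/-- The class sum of `y` acts in an irreducible representation with character `χ` and degree `d`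
as the scalar `|C(y)| χ(y) / d`. -/
theorem asAlgebraHom_classSum_eq_smul {G : Type*} [Group G] [Finite G] {V : Type*}
    [AddCommGroup V] [Module ℂ V] [FiniteDimensional ℂ V] {ρ : Representation ℂ G V}
    (hρ : ρ.IsIrreducible) (y : G) :
    ρ.asAlgebraHom (classSum y) =
      (Nat.card (conjugatesOf y) * ρ.character y / Module.finrank ℂ V : ℂ) • 1 := by
  have := nontrivial_of_irreducible ρ hρ
  have hd : (Module.finrank ℂ V : ℂ) ≠ 0 := by simp [Module.finrank_pos.ne']
  obtain ⟨c, hc⟩ := exists_eq_smul_one_of_commute hρ (ρ.asAlgebraHom (classSum y)) fun h => by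
    rw [asAlgebraHom_classSum, Finset.sum_mul, Finset.mul_sum]
    refine Finset.sum_equiv (MulAut.conj h⁻¹).toEquiv (fun g => ?_) fun g _ => ?_
    · simp only [Set.Finite.mem_toFinset, conjugatesOf, Set.mem_ofPred_eq]
      exact ⟨fun hg => hg.trans (isConj_iff.2 ⟨h⁻¹, rfl⟩),
        fun hg => hg.trans (isConj_iff.2 ⟨h, by simp [mul_assoc]⟩)⟩
    · rw [← map_mul, ← map_mul]
      simp [mul_assoc]
  have htr := congrArg (LinearMap.trace ℂ V) hc
  have hχ : ∀ g ∈ (Set.toFinite (conjugatesOf y)).toFinset,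
      LinearMap.trace ℂ V (ρ g) = ρ.character y := fun g hg => by
    rw [Set.Finite.mem_toFinset, conjugatesOf, Set.mem_ofPred_eq] at hg
    obtain ⟨k, rfl⟩ := isConj_iff.1 hg
    change ρ.character _ = _
    rw [ρ.char_mul_comm, inv_mul_cancel_left]
  rw [asAlgebraHom_classSum, map_sum, Finset.sum_congr rfl hχ, Finset.sum_const, map_smul,
    LinearMap.trace_one, ← Set.ncard_eq_toFinset_card, ← Nat.card_coe_set_eq, nsmul_eq_mul,
    smul_eq_mul] at htr
  rw [hc, htr, mul_div_cancel_right₀ _ hd]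

/-- The action on each extension of `η` determines an element of the ideal `ℂ[G] e_η`. -/
theorem mul_incl_pci_eq_sum {G : Type*} [Group G] [Finite G] {H : Subgroup G} {W : Type*}
    [AddCommGroup W] [Module ℂ W] [FiniteDimensional ℂ W] {η : Representation ℂ H W} {n : ℕ}
    {ρ : Fin n → Representation ℂ G W} (hirr : ∀ i, (ρ i).IsIrreducible)
    (hsum : incl H (pci η) = ∑ i, pci (ρ i)) {a : MonoidAlgebra ℂ G} {c : Fin n → ℂ}
    (ha : ∀ i, (ρ i).asAlgebraHom a = c i • 1) :
    a * incl H (pci η) = ∑ i, c i • pci (ρ i) := by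
  rw [hsum, Finset.mul_sum]
  exact Finset.sum_congr rfl fun i _ => mul_pci_eq_smul (hirr i) (ha i)

theorem asAlgebraHom_incl_pci {G : Type*} [Group G] [Finite G] {H : Subgroup G} {W : Type*}
    [AddCommGroup W] [Module ℂ W] [FiniteDimensional ℂ W] {η : Representation ℂ H W}
    (hη : η.IsIrreducible) {ρ : Representation ℂ G W} (hρ : ρ.comp H.subtype = η) :
    ρ.asAlgebraHom (incl H (pci η)) = 1 := by
  rw [asAlgebraHom_incl, hρ, asAlgebraHom_pci_self η hη]

/-- If the characters of two extensions of `η` both vanish off `H`, then they coincide, and the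
extensions are equivalent. -/
theorem exists_character_ne_zero {G : Type*} [Group G] [Finite G] {H : Subgroup G}
    {W : Type*} [AddCommGroup W] [Module ℂ W] [FiniteDimensional ℂ W]
    {η : Representation ℂ H W} {ρ σ : Representation ℂ G W}
    (hρ : ρ.comp H.subtype = η) (hσ : σ.comp H.subtype = η) (hρi : ρ.IsIrreducible)
    (hσi : σ.IsIrreducible) (h : ¬ Nonempty (Representation.Equiv ρ σ)) :
    ∃ y ∉ H, ρ.character y ≠ 0 ∨ σ.character y ≠ 0 := by
  contrapose! h
  have hχ : ∀ g, ρ.character g = σ.character g := fun g => by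
    by_cases hg : g ∈ H
    · have h1 : ρ g = η ⟨g, hg⟩ := DFunLike.congr_fun hρ ⟨g, hg⟩
      have h2 : σ g = η ⟨g, hg⟩ := DFunLike.congr_fun hσ ⟨g, hg⟩
      rw [character, character, h1, h2]
    · rw [(h g hg).1, (h g hg).2]
  have hpci : pci ρ = pci σ := by simp only [pci, hχ]
  rw [← asAlgebraHom_pci_ne_zero_iff hρi hσi, hpci, asAlgebraHom_pci_self σ hσi]
  have := nontrivial_of_irreducible σ hσi
  exact one_ne_zero

/-- Let `z` run through all `p`-th roots of unity. After a renumbering `π`, `z (π i)` is the inverse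
of `ζ ^ i`, so that averaging the powers of `ζ ^ i * z j` over a period picks out `j = π i`. -/
theorem exists_perm_geom_sum {p : ℕ} (hp : p ≠ 0) {ζ : ℂ} (hζ : IsPrimitiveRoot ζ p)
    {z : Fin p → ℂ} (hz : ∀ i, z i ^ p = 1) (hinj : Function.Injective z) :
    ∃ π : Equiv.Perm (Fin p), ∀ i j : Fin p,
      (1 / p : ℂ) * ∑ k ∈ Finset.range p, ζ ^ ((i : ℕ) * k) * z j ^ k =
        if j = π i then 1 else 0 := by
  have := NeZero.mk hp
  have hz0 : ∀ i, z i ≠ 0 := fun i h => by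
    have := hz i
    rw [h, zero_pow hp] at this
    exact zero_ne_one this
  have hm : ∀ j, ∃ i : Fin p, ζ ^ (i : ℕ) = (z j)⁻¹ := fun j => by
    obtain ⟨i, hi, h⟩ := hζ.eq_pow_of_pow_eq_one (ξ := (z j)⁻¹) (by rw [inv_pow, hz, inv_one])
    exact ⟨⟨i, hi⟩, h⟩
  choose m hm using hm
  have hmi : Function.Injective m := fun j j' h =>
    hinj (inv_injective (by rw [← hm, ← hm, h]))
  let π := (Equiv.ofBijective m (Finite.injective_iff_bijective.1 hmi)).symm
  have hπ : ∀ i : Fin p, ζ ^ (i : ℕ) = (z (π i))⁻¹ := fun i => by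
    rw [← hm, show m (π i) = i from (Equiv.ofBijective m _).apply_symm_apply i]
  refine ⟨π, fun i j => ?_⟩
  have hterm : ∀ k, ζ ^ ((i : ℕ) * k) * z j ^ k = (ζ ^ (i : ℕ) * z j) ^ k := fun k => by
    rw [mul_pow, pow_mul]
  simp only [hterm]
  split_ifs with h
  · rw [h, hπ, inv_mul_cancel₀ (hz0 _)]
    simp [hp]
  · have h1 : ζ ^ (i : ℕ) * z j ≠ 1 := fun h1 => h (hinj (by
      rw [hπ, inv_mul_eq_one₀ (hz0 _)] at h1
      exact h1.symm))
    have h2 : (ζ ^ (i : ℕ) * z j) ^ p = 1 := by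
      rw [mul_pow, hz, ← pow_mul, mul_comm (i : ℕ), pow_mul, hζ.pow_eq_one, one_pow, mul_one]
    rw [geom_sum_eq h1, h2, sub_self, zero_div, mul_zero]

/-- At a generator `y` of `G` modulo `H`, the characters of two extensions of `η` differ by a root
of unity of order dividing the index, and, if they do not vanish there, the value at `y` determines
the extension. The same then holds for the scalars by which the class sum of `y` acts. -/
theorem character_relations_of_comp_subtype {G : Type*} [Group G] {H : Subgroup G} [H.Normal]
    {W : Type*} [AddCommGroup W] [Module ℂ W] [FiniteDimensional ℂ W]
    {η : Representation ℂ H W} (hη : η.IsIrreducible) {ρ σ : Representation ℂ G W}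
    (hρ : ρ.comp H.subtype = η) (hσ : σ.comp H.subtype = η) {y : G}
    (hy : Subgroup.zpowers (y : G ⧸ H) = ⊤) :
    ρ.character y ^ H.index = σ.character y ^ H.index ∧
      (ρ.character y = σ.character y → σ.character y ≠ 0 → ρ = σ) := by
  have := nontrivial_of_irreducible η hη
  obtain ⟨c, hc⟩ := exists_smul_eq_of_comp_subtype hη hρ hσ y
  have hχ : ρ.character y = c * σ.character y := by
    rw [character, hc, map_smul, smul_eq_mul]
    rfl
  refine ⟨?_, fun h h0 => ext_of_comp_subtype hy (hρ.trans hσ.symm) ?_⟩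
  · rw [hχ, mul_pow, pow_index_eq_one_of_eq_smul (hρ.trans hσ.symm) hy hc, one_mul]
  · have hc1 : c = 1 := mul_right_cancel₀ h0 (by rw [← hχ, h, one_mul])
    rw [hc, hc1, one_smul]

theorem exists_extensions_of_mem_center {G : Type*} [Group G] [Finite G] {H : Subgroup G}
    [H.Normal] {p : ℕ} (hp : p.Prime) (hindex : H.index = p) {x : G}
    (hx : Subgroup.zpowers (x : G ⧸ H) = ⊤)
    {W : Type*} [AddCommGroup W] [Module ℂ W] [FiniteDimensional ℂ W]
    {η : Representation ℂ H W} (hη : η.IsIrreducible)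
    (hcent : incl H (pci η) ∈ Set.center (MonoidAlgebra ℂ G)) :
    ∃ ρ : Fin p → Representation ℂ G W,
      (∀ i, (ρ i).comp H.subtype = η) ∧
      (∀ i, (ρ i).IsIrreducible) ∧
      (∀ i j, i ≠ j → IsEmpty (Representation.Equiv (ρ i) (ρ j))) ∧
      (∀ σ : Representation ℂ G W, σ.comp H.subtype = η → ∃ i, σ = ρ i) ∧
      (∃ y : G, Subgroup.zpowers (y : G ⧸ H) = ⊤ ∧ ∃ l : ℂ, l ≠ 0 ∧
        classSum y ^ p * incl H (pci η) = l • incl H (pci η)) ∧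
      (∀ y : G, Subgroup.zpowers (y : G ⧸ H) = ⊤ → ∀ l : ℂ, l ≠ 0 →
        classSum y ^ p * incl H (pci η) = l • incl H (pci η) →
        ∀ r : ℂ, r ^ p = l → ∀ ζ : ℂ, IsPrimitiveRoot ζ p →
        ∃ π : Equiv.Perm (Fin p), ∀ i : Fin p,
          pci (ρ (π i)) =
            (1 / (p : ℂ)) • ((∑ k ∈ Finset.range p, ζ ^ ((i : ℕ) * k) •
              (r⁻¹ • (classSum y * incl H (pci η))) ^ k) * incl H (pci η))) ∧
      incl H (pci η) = ∑ i, pci (ρ i) := by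
  have hW := nontrivial_of_irreducible η hη
  obtain ⟨e⟩ := nonempty_equiv_conjRep hη (g := x) ((Set.mem_center_iff.1 hcent).comm _)
  obtain ⟨ρ₀, hρ₀⟩ := exists_extension_of_equiv hx (hindex ▸ hp.ne_zero) hη e
  obtain ⟨ρ, hρ, hinj, hall, hzero⟩ := exists_extensions hp hindex hx hη ρ₀ hρ₀
  have hirr : ∀ i, (ρ i).IsIrreducible := fun i =>
    isIrreducible_of_comp _ H.subtype (by rw [hρ i]; exact hη)
  have hne : ∀ i j, i ≠ j → IsEmpty (Representation.Equiv (ρ i) (ρ j)) := fun i j hij =>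
    ⟨fun e => hij (hinj (eq_of_equiv_of_comp_subtype hη (hρ i) (hρ j) e))⟩
  have hsum := incl_pci_eq_sum hindex hρ hzero
  -- the scalar by which the class sum of `y` acts in `ρ i`
  let ω : G → Fin p → ℂ := fun y i =>
    Nat.card (conjugatesOf y) * (ρ i).character y / Module.finrank ℂ W
  have hω : ∀ y i, (ρ i).asAlgebraHom (classSum y) = ω y i • 1 := fun y i =>
    asAlgebraHom_classSum_eq_smul (hirr i) y
  have hcard : ∀ y : G, (Nat.card (conjugatesOf y) : ℂ) ≠ 0 := fun y => by
    have : Nonempty (conjugatesOf y) := ⟨⟨y, mem_conjugatesOf_self⟩⟩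
    exact_mod_cast Nat.card_pos.ne'
  have hd : (Module.finrank ℂ W : ℂ) ≠ 0 := by simp [Module.finrank_pos.ne']
  have hωpow : ∀ y i, (ρ i).asAlgebraHom (classSum y ^ p) = ω y i ^ p • 1 := fun y i => by
    rw [map_pow, hω, smul_pow, one_pow]
  refine ⟨ρ, hρ, hirr, hne, hall, ?_, ?_, hsum⟩
  -- some extension has a nonzero character value off `H`, and any `y` with this property will do
  · have h01 : (⟨0, hp.pos⟩ : Fin p) ≠ ⟨1, hp.one_lt⟩ := by simp
    obtain ⟨y, hyH, hy⟩ := exists_character_ne_zero (hρ _) (hρ _) (hirr _) (hirr _)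
      (not_nonempty_iff.2 (hne _ _ h01))
    obtain ⟨i, hi⟩ : ∃ i, (ρ i).character y ≠ 0 := hy.elim (fun h => ⟨_, h⟩) fun h => ⟨_, h⟩
    have hygen := zpowers_mk_eq_top hp hindex hyH
    refine ⟨y, hygen, ω y i ^ p, pow_ne_zero _ (div_ne_zero (mul_ne_zero (hcard y) hi) hd), ?_⟩
    rw [mul_incl_pci_eq_sum hirr hsum (hωpow y), hsum, Finset.smul_sum]
    refine Finset.sum_congr rfl fun j _ => ?_
    have h := (character_relations_of_comp_subtype hη (hρ j) (hρ i) hygen).1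
    rw [hindex] at h
    simp only [ω, div_pow, mul_pow, h]
  -- `c` acts in the `ρ i` as the distinct `p`-th roots of unity `r⁻¹ * ω y i`
  · intro y hygen l hl hyl r hr ζ hζ
    have hωl : ∀ i, ω y i ^ p = l := fun i => by
      have h := congrArg (ρ i).asAlgebraHom hyl
      rw [map_mul, map_smul, asAlgebraHom_incl_pci hη (hρ i), mul_one, hωpow] at h
      exact smul_left_injective ℂ (one_ne_zero (α := Module.End ℂ W)) h
    have hr0 : r ≠ 0 := by
      rintro rfl
      exact hl (by rw [← hr, zero_pow hp.ne_zero])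
    have hω0 : ∀ i, (ρ i).character y ≠ 0 := fun i h0 => by
      refine hl ?_
      rw [← hωl i]
      simp [ω, h0, hp.ne_zero]
    obtain ⟨π, hπ⟩ := exists_perm_geom_sum hp.ne_zero hζ (z := fun i => r⁻¹ * ω y i)
      (fun i => by rw [mul_pow, hωl, inv_pow, hr, inv_mul_cancel₀ hl]) fun i j hij => by
        have h1 : ω y i = ω y j := mul_left_cancel₀ (inv_ne_zero hr0) hij
        have h2 : (ρ i).character y = (ρ j).character y :=
          mul_left_cancel₀ (hcard y) ((div_left_inj' hd).1 h1)
        exact hinj ((character_relations_of_comp_subtype hη (hρ i) (hρ j) hygen).2 h2 (hω0 j))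
    refine ⟨π, fun i => ?_⟩
    rw [← smul_mul_assoc, mul_incl_pci_eq_sum hirr hsum (c := fun j => if j = π i then 1 else 0)
      fun j => ?_]
    · simp
    · rw [← hπ, map_smul, map_sum, mul_smul, Finset.sum_smul]
      congr 1
      refine Finset.sum_congr rfl fun k _ => ?_
      rw [map_smul, map_pow, map_smul, map_mul, hω, asAlgebraHom_incl_pci hη (hρ j), mul_one,
        smul_smul, smul_pow, one_pow, smul_smul]

/-! ### Induction from a subgroup -/

/-- The `G`-map from the representation induced from `η` to `σ` which corresponds under Frobenius
reciprocity to an `H`-map `f` from `η` to `σ`. As `⟦g ⊗ w⟧` is the translate by `g⁻¹` of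
`⟦1 ⊗ w⟧`, it goes to `σ g⁻¹ (f w)`. -/
noncomputable def indLift {G : Type*} [Group G] {H : Subgroup G} {V W : Type*}
    [AddCommGroup V] [Module ℂ V] [AddCommGroup W] [Module ℂ W] {η : Representation ℂ H W}
    {σ : Representation ℂ G V}
    (f : IntertwiningMap η (σ.comp H.subtype : Representation ℂ H V)) :
    IntertwiningMap (ind H.subtype η) σ where
  toLinearMap := Coinvariants.lift _
    (TensorProduct.lift ((Finsupp.lift _ _ _ fun g => σ g⁻¹ ∘ₗ f.toLinearMap) ∘ₗ
      (MonoidAlgebra.coeffLinearEquiv ℂ).toLinearMap)) fun h => by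
      have hf : ∀ w, f (η h w) = σ h (f w) := fun w => f.isIntertwining η _ h w
      ext g w
      simp only [LinearMap.coe_comp, Function.comp_apply, MonoidAlgebra.lsingle_apply]
      simp [ofMulAction_single, mul_inv_rev, hf]
  isIntertwining' g := by ext; simp

theorem indLift_mk {G : Type*} [Group G] {H : Subgroup G} {V W : Type*}
    [AddCommGroup V] [Module ℂ V] [AddCommGroup W] [Module ℂ W] {η : Representation ℂ H W}
    {σ : Representation ℂ G V}
    (f : IntertwiningMap η (σ.comp H.subtype : Representation ℂ H V)) (g : G) (w : W) :
    indLift f (IndV.mk H.subtype η g w) = σ g⁻¹ (f w) := by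
  simp [indLift]

theorem indV_mk_mul {G : Type*} [Group G] {H : Subgroup G} {W : Type*} [AddCommGroup W]
    [Module ℂ W] (η : Representation ℂ H W) (h : H) (g : G) (w : W) :
    IndV.mk H.subtype η (h * g) w = IndV.mk H.subtype η g (η h⁻¹ w) := by
  simp

/-- The induced representation is spanned by the translates of `W` by coset representatives, here
the first powers of `x`. -/
theorem finrank_indV_le {G : Type*} [Group G] {H : Subgroup G} [H.Normal] {p : ℕ} (hp : p ≠ 0)
    (hindex : H.index = p) {x : G} (hx : Subgroup.zpowers (x : G ⧸ H) = ⊤) {W : Type*}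
    [AddCommGroup W] [Module ℂ W] [FiniteDimensional ℂ W] (η : Representation ℂ H W) :
    FiniteDimensional ℂ (IndV H.subtype η) ∧
      Module.finrank ℂ (IndV H.subtype η) ≤ p * Module.finrank ℂ W := by
  let F : (Fin p → W) →ₗ[ℂ] IndV H.subtype η :=
    ∑ i : Fin p, IndV.mk H.subtype η (x ^ (i : ℕ)) ∘ₗ LinearMap.proj i
  have hF : ∀ (i : Fin p) w, IndV.mk H.subtype η (x ^ (i : ℕ)) w ∈ LinearMap.range F :=
    fun i w => ⟨Pi.single i w, by
      simp only [F, LinearMap.sum_apply, LinearMap.comp_apply, LinearMap.proj_apply]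
      rw [Finset.sum_eq_single i (fun j _ hj => by simp [Pi.single_eq_of_ne hj])
        (by simp), Pi.single_eq_same]⟩
  have hrange : ∀ (g : G) w, IndV.mk H.subtype η g w ∈ LinearMap.range F := fun g w => by
    obtain ⟨h, k, rfl⟩ := exists_eq_mul_zpow hx g
    have hp0 : (p : ℤ) ≠ 0 := by exact_mod_cast hp
    obtain ⟨i, hi⟩ := Int.eq_ofNat_of_zero_le (Int.emod_nonneg k hp0)
    have hip : i < p := by
      have := Int.emod_lt_of_pos k (b := (p : ℤ)) (by omega)
      omega
    have hmem : x ^ (p * (k / p) : ℤ) ∈ H :=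
      (zpow_mem_iff_dvd hx _).2 (hindex ▸ dvd_mul_right _ _)
    have hk : x ^ k = ((⟨_, hmem⟩ : H) : G) * x ^ i := by
      rw [← zpow_natCast x i, ← zpow_add, ← hi, Int.mul_ediv_add_emod]
    rw [hk, indV_mk_mul, indV_mk_mul]
    exact hF ⟨i, hip⟩ _
  have hsurj : Function.Surjective F := by
    rw [← LinearMap.range_eq_top, ← Submodule.ker_mkQ (LinearMap.range F), LinearMap.ker_eq_top]
    refine IndV.hom_ext _ _ fun g => LinearMap.ext fun w => ?_
    simpa using hrange g w
  refine ⟨Module.Finite.of_surjective F hsurj, ?_⟩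
  simpa [Module.finrank_pi_fintype] using LinearMap.finrank_le_finrank_of_surjective hsurj

/-! ### Inducing a representation with trivial stabilizer -/

theorem intertwiningMap_asAlgebraHom {K : Type*} [Group K] {V W : Type*} [AddCommGroup V]
    [Module ℂ V] [AddCommGroup W] [Module ℂ W] {ρ : Representation ℂ K V}
    {σ : Representation ℂ K W} (f : IntertwiningMap ρ σ) (a : MonoidAlgebra ℂ K) (v : V) :
    f (ρ.asAlgebraHom a v) = σ.asAlgebraHom a (f v) := by
  induction a using MonoidAlgebra.induction_on with
  | of g => simpa using f.isIntertwining _ _ g v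
  | add x y hx hy => simp only [map_add, LinearMap.add_apply, hx, hy]
  | smul r f hf => simp only [map_smul, LinearMap.smul_apply, hf]

theorem isIrreducible_of_equiv {K : Type*} [Group K] {V W : Type*} [AddCommGroup V]
    [Module ℂ V] [AddCommGroup W] [Module ℂ W] {ρ : Representation ℂ K V}
    {σ : Representation ℂ K W} (e : Representation.Equiv ρ σ) (h : ρ.IsIrreducible) :
    σ.IsIrreducible := by
  rw [irreducible_iff_isSimpleModule_asModule] at h ⊢
  have hb : Function.Bijective (IntertwiningMap.equivLinearMapAsModule ρ σ e.toIntertwiningMap) :=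
    e.toLinearEquiv.bijective
  exact IsSimpleModule.congr (LinearEquiv.ofBijective _ hb).symm

/-- As `e_η` commutes with `H`, it is central once it commutes with a generator of `G` modulo
`H`. -/
theorem incl_pci_mem_center {G : Type*} [Group G] [Finite G] {H : Subgroup G} [H.Normal]
    {W : Type*} [AddCommGroup W] [Module ℂ W] (η : Representation ℂ H W) {y : G}
    (hy : Subgroup.zpowers (y : G ⧸ H) = ⊤)
    (hcomm : Commute (incl H (pci η)) (MonoidAlgebra.single y 1)) :
    incl H (pci η) ∈ Set.center (MonoidAlgebra ℂ G) := by
  rw [Semigroup.mem_center_iff]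
  intro b
  suffices Commute (incl H (pci η)) b from this.eq.symm
  induction b using MonoidAlgebra.induction_on with
  | of g =>
    obtain ⟨h, k, rfl⟩ := exists_eq_mul_zpow hy g
    rw [map_mul]
    have h1 : Commute (incl H (pci η)) (MonoidAlgebra.of ℂ G h) := by
      have := congrArg (incl H)
        ((Set.mem_center_iff.1 (pci_mem_center η)).comm (MonoidAlgebra.single h 1)).eq
      rwa [map_mul, map_mul, incl_single] at this
    have h2 : Commute (incl H (pci η)) ((MonoidAlgebra.of ℂ G).toHomUnits y) := hcomm
    have h3 := h2.units_zpow_right k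
    rw [← map_zpow] at h3
    exact h1.mul_right h3
  | add x y hx hy => exact hx.add_right hy
  | smul r f hf => exact hf.smul_right r

/-- An equivalence of `η^(x ^ i)` and `η^(x ^ j)` makes `e_η` commute with `x ^ (i - j)`, which
generates `G` modulo `H` unless `i = j`. -/
theorem not_equiv_conjRep {G : Type*} [Group G] [Finite G] {H : Subgroup G} [H.Normal] {p : ℕ}
    (hp : p.Prime) (hindex : H.index = p) {x : G} (hx : Subgroup.zpowers (x : G ⧸ H) = ⊤)
    {W : Type*} [AddCommGroup W] [Module ℂ W] {η : Representation ℂ H W}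
    (hcent : incl H (pci η) ∉ Set.center (MonoidAlgebra ℂ G)) {i j : ℕ} (hi : i < p) (hj : j < p)
    (hij : i ≠ j) : ¬ Nonempty (Representation.Equiv (conjRep η (x ^ i)) (conjRep η (x ^ j))) := by
  rintro ⟨e⟩
  refine hcent (incl_pci_mem_center η (y := x ^ i * (x ^ j)⁻¹) ?_ ?_)
  · refine zpowers_mk_eq_top hp hindex ?_
    rw [← zpow_natCast, ← zpow_natCast, ← zpow_neg, ← zpow_add, zpow_mem_iff_dvd hx, hindex]
    intro hd
    have := Int.eq_zero_of_abs_lt_dvd hd (abs_lt.2 (by omega))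
    omega
  · have h1 := congrArg (incl H) (pci_eq_of_equiv e)
    rw [incl_pci_conjRep, incl_pci_conjRep] at h1
    have h2 := congrArg
      (fun a => MonoidAlgebra.single (x ^ i) 1 * a * MonoidAlgebra.single (x ^ j)⁻¹ 1) h1
    have h3 : ∀ (g : G) (a : MonoidAlgebra ℂ G),
        MonoidAlgebra.single g 1 * (MonoidAlgebra.single g⁻¹ 1 * a) = a := fun g a => by
      rw [← mul_assoc, MonoidAlgebra.single_mul_single, mul_inv_cancel, one_mul,
        ← MonoidAlgebra.one_def, one_mul]
    simp only [mul_assoc, h3, MonoidAlgebra.single_mul_single, mul_inv_cancel, mul_one,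
      ← MonoidAlgebra.one_def] at h2
    rw [commute_iff_eq, h2, ← mul_assoc, MonoidAlgebra.single_mul_single, mul_one]

/-- Let `σ` be an irreducible representation of `G` whose restriction to `H` contains `η`, where
the conjugates `η^(x ^ i)` for `i < p` are pairwise inequivalent. Then `σ` contains all of them, and the sum of one
copy of each has dimension `p * dim W`. As `σ` is a quotient of the representation induced from
each of them, which has at most this dimension, both are equivalent, and `σ` is this sum. -/
theorem equiv_ind_of_asAlgebraHom_ne_zero {G : Type*} [Group G] [Finite G] {H : Subgroup G}
    [H.Normal] {p : ℕ} (hp : p.Prime) (hindex : H.index = p) {x : G}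
    (hx : Subgroup.zpowers (x : G ⧸ H) = ⊤) {V W : Type*} [AddCommGroup W] [Module ℂ W]
    [FiniteDimensional ℂ W] {η : Representation ℂ H W} (hη : η.IsIrreducible)
    (hcent : incl H (pci η) ∉ Set.center (MonoidAlgebra ℂ G)) [AddCommGroup V] [Module ℂ V]
    [FiniteDimensional ℂ V] {σ : Representation ℂ G V} (hσ : σ.IsIrreducible)
    (h : σ.asAlgebraHom (incl H (pci η)) ≠ 0) :
    (∀ i < p, Nonempty (Representation.Equiv (ind H.subtype (conjRep η (x ^ i))) σ)) ∧
      σ.asAlgebraHom (∑ i ∈ Finset.range p, incl H (pci (conjRep η (x ^ i)))) = 1 := by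
  let τ : Representation ℂ H V := σ.comp H.subtype
  have hirr := fun i : ℕ => conjRep_isIrreducible hη (x ^ i)
  have hne : ∀ i : ℕ, τ.asAlgebraHom (pci (conjRep η (x ^ i))) ≠ 0 := fun i h0 => by
    rw [← asAlgebraHom_incl, incl_pci_conjRep, map_mul, map_mul] at h0
    have h1 := congrArg
      (fun a => σ.asAlgebraHom (MonoidAlgebra.single (x ^ i) 1) * a *
        σ.asAlgebraHom (MonoidAlgebra.single (x ^ i)⁻¹ 1)) h0
    simp only [← map_mul, mul_zero, zero_mul] at h1
    refine h ?_
    rw [← h1]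
    congr 1
    rw [mul_assoc, mul_assoc, mul_assoc, MonoidAlgebra.single_mul_single, ← mul_assoc,
      MonoidAlgebra.single_mul_single, mul_inv_cancel, one_mul, ← MonoidAlgebra.one_def, one_mul,
      mul_one]
  choose f hf using fun i => exists_intertwiningMap_ne_zero _ τ (hne i)
  have hfinj : ∀ i, Function.Injective (f i) := fun i =>
    (IsIrreducible.injective_or_eq_zero (f i)).resolve_right (hf i)
  -- the idempotent of the `j`-th conjugate projects to the `j`-th summand
  have hproj : ∀ i j : Fin p, ∀ w,
      τ.asAlgebraHom (pci (conjRep η (x ^ (j : ℕ)))) (f i w) = if i = j then f i w else 0 := by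
    intro i j w
    rw [← intertwiningMap_asAlgebraHom]
    split_ifs with hij
    · subst hij
      rw [asAlgebraHom_pci_self _ (hirr i), Module.End.one_apply]
    · rw [(asAlgebraHom_pci _ (hirr j) _ (hirr i)).2 (not_equiv_conjRep hp hindex hx hcent j.2 i.2
        fun h => hij (Fin.ext h.symm)), LinearMap.zero_apply, map_zero]
  let Φ : (Fin p → W) →ₗ[ℂ] V := ∑ i : Fin p, (f i).toLinearMap ∘ₗ LinearMap.proj i
  have hΦ : ∀ w, Φ w = ∑ i : Fin p, f i (w i) := fun w => by
    simp [Φ, LinearMap.sum_apply]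
  have hΦproj : ∀ (j : Fin p) w,
      τ.asAlgebraHom (pci (conjRep η (x ^ (j : ℕ)))) (Φ w) = f j (w j) := fun j w => by
    rw [hΦ, map_sum]
    simp [hproj]
  have hΦinj : Function.Injective Φ := by
    rw [injective_iff_map_eq_zero]
    intro w hw
    funext j
    refine hfinj j ?_
    rw [← hΦproj, hw, map_zero, Pi.zero_apply, map_zero]
  have hdim : p * Module.finrank ℂ W ≤ Module.finrank ℂ V := by
    simpa [Module.finrank_pi_fintype] using LinearMap.finrank_le_finrank_of_injective hΦinj
  have hsurj : ∀ i, Function.Surjective (indLift (f i)) := fun i =>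
    (IsIrreducible.surjective_or_eq_zero (indLift (f i))).resolve_right fun h0 => by
      refine hf i (DFunLike.ext _ _ fun w => ?_)
      have := DFunLike.congr_fun h0 (IndV.mk H.subtype _ 1 w)
      rw [indLift_mk] at this
      simpa using this
  have hfd := fun i : ℕ => finrank_indV_le hp.ne_zero hindex hx (conjRep η (x ^ i))
  have hle : ∀ i, Module.finrank ℂ V ≤ Module.finrank ℂ (IndV H.subtype (conjRep η (x ^ i))) :=
    fun i => by
      have := (hfd i).1
      exact LinearMap.finrank_le_finrank_of_surjective (f := (indLift (f i)).toLinearMap) (hsurj i)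
  refine ⟨fun i _ => ⟨(indLift (f i)).ofBijective ⟨?_, hsurj i⟩⟩, ?_⟩
  · have := (hfd i).1
    exact (LinearMap.injective_iff_surjective_of_finrank_eq_finrank
      (f := (indLift (f i)).toLinearMap) (le_antisymm ((hfd i).2.trans hdim) (hle i))).2 (hsurj i)
  · have hΦsurj : Function.Surjective Φ :=
      (LinearMap.injective_iff_surjective_of_finrank_eq_finrank (by
        simpa [Module.finrank_pi_fintype] using le_antisymm hdim ((hle 0).trans (hfd 0).2))).1 hΦinj
    ext v
    obtain ⟨w, rfl⟩ := hΦsurj v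
    rw [map_sum, LinearMap.sum_apply, Module.End.one_apply, Finset.sum_range]
    simp only [asAlgebraHom_incl]
    exact (Finset.sum_congr rfl fun j _ => hΦproj j w).trans (hΦ w).symm

theorem exists_ind_equiv_of_notMem_center {G : Type*} [Group G] [Finite G] {H : Subgroup G}
    [H.Normal] {p : ℕ} (hp : p.Prime) (hindex : H.index = p) {x : G}
    (hx : Subgroup.zpowers (x : G ⧸ H) = ⊤)
    {W : Type*} [AddCommGroup W] [Module ℂ W] [FiniteDimensional ℂ W]
    {η : Representation ℂ H W} (hη : η.IsIrreducible)
    (hcent : incl H (pci η) ∉ Set.center (MonoidAlgebra ℂ G)) :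
    ∃ (n : ℕ) (ρ : Representation ℂ G (Fin n → ℂ)),
      ρ.IsIrreducible ∧
      (∀ i < p, Nonempty (Representation.Equiv
        (Representation.ind H.subtype (conjRep η (x ^ i))) ρ)) ∧
      pci ρ = ∑ i ∈ Finset.range p, incl H (pci (conjRep η (x ^ i))) := by
  have hne : incl H (pci η) ≠ 0 :=
    (map_ne_zero_iff _ (incl_injective H)).2 (pci_isPrimitiveCentralIdempotent η hη).ne_zero
  -- some irreducible representation contains `η`, and it may be taken on a coordinate space
  obtain ⟨n, ρ, hρ, hρe⟩ : ∃ (n : ℕ) (ρ : Representation ℂ G (Fin n → ℂ)),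
      ρ.IsIrreducible ∧ ρ.asAlgebraHom (incl H (pci η)) ≠ 0 := by
    contrapose! hne
    refine eq_zero_of_forall_irreducible _ fun V _ _ _ σ hσ => ?_
    let φ := (Module.finBasis ℂ V).equivFun
    let ρ : Representation ℂ G (Fin (Module.finrank ℂ V) → ℂ) :=
      φ.conjRingEquiv.toMonoidHom.comp σ
    let e : Representation.Equiv σ ρ := .mk φ fun g => by
      ext v
      simp [ρ, LinearEquiv.conjRingEquiv]
    exact asAlgebraHom_eq_zero_of_equiv e.symm _ (hne _ ρ (isIrreducible_of_equiv e hσ))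
  have hind := equiv_ind_of_asAlgebraHom_ne_zero hp hindex hx hη hcent hρ hρe
  refine ⟨n, ρ, hρ, hind.1, sub_eq_zero.1 (eq_zero_of_forall_irreducible _
    fun V _ _ _ σ hσ => ?_)⟩
  rw [map_sub]
  by_cases h : σ.asAlgebraHom (incl H (pci η)) = 0
  · have h1 : ¬ Nonempty (Representation.Equiv ρ σ) := fun ⟨e⟩ =>
      hρe (asAlgebraHom_eq_zero_of_equiv e.symm _ h)
    rw [(asAlgebraHom_pci ρ hρ σ hσ).2 h1, map_sum]
    simp [incl_pci_conjRep, h]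
  · have hσind := equiv_ind_of_asAlgebraHom_ne_zero hp hindex hx hη hcent hσ h
    obtain ⟨e₁⟩ := hind.1 0 hp.pos
    obtain ⟨e₂⟩ := hσind.1 0 hp.pos
    rw [hσind.2, (asAlgebraHom_pci ρ hρ σ hσ).1 ⟨e₁.symm.trans e₂⟩, sub_self]

end GroupAlg

theorem mainTheorem1 {G : Type*} [Group G] [Finite G] (H : Subgroup G) [H.Normal] (p : ℕ)
    (hp : p.Prime) (hindex : H.index = p)
    (x : G) (hx : Subgroup.zpowers (x : G ⧸ H) = ⊤)
    {W : Type*} [AddCommGroup W] [Module ℂ W] [FiniteDimensional ℂ W]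
    (η : Representation ℂ H W) (hη : η.IsIrreducible) :
    -- case (1): `e_η` is central in `ℂ[G]`
    (GroupAlg.incl H (GroupAlg.pci η) ∈ Set.center (MonoidAlgebra ℂ G) →
      -- `η` extends to exactly `p` representations of `G`, irreducible, pairwise inequivalent
      ∃ ρ : Fin p → Representation ℂ G W,
        (∀ i, (ρ i).comp H.subtype = η) ∧
        (∀ i, (ρ i).IsIrreducible) ∧
        (∀ i j, i ≠ j → IsEmpty (Representation.Equiv (ρ i) (ρ j))) ∧
        (∀ σ : Representation ℂ G W, σ.comp H.subtype = η → ∃ i, σ = ρ i) ∧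
        -- the generator can be chosen with `λ ≠ 0`
        (∃ y : G, Subgroup.zpowers (y : G ⧸ H) = ⊤ ∧ ∃ l : ℂ, l ≠ 0 ∧
          GroupAlg.classSum y ^ p * GroupAlg.incl H (GroupAlg.pci η) =
            l • GroupAlg.incl H (GroupAlg.pci η)) ∧
        -- for every such choice, every `p`-th root `r` of `λ` and every primitive `p`-th root of
        -- unity `ζ`, the formula for the `e_{ρ_i}` holds in a suitable numbering of the `ρ_i`
        (∀ y : G, Subgroup.zpowers (y : G ⧸ H) = ⊤ → ∀ l : ℂ, l ≠ 0 →
          GroupAlg.classSum y ^ p * GroupAlg.incl H (GroupAlg.pci η) =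
            l • GroupAlg.incl H (GroupAlg.pci η) →
          ∀ r : ℂ, r ^ p = l → ∀ ζ : ℂ, IsPrimitiveRoot ζ p →
          ∃ π : Equiv.Perm (Fin p), ∀ i : Fin p,
            GroupAlg.pci (ρ (π i)) =
              (1 / (p : ℂ)) • ((∑ k ∈ Finset.range p, ζ ^ ((i : ℕ) * k) •
                (r⁻¹ • (GroupAlg.classSum y * GroupAlg.incl H (GroupAlg.pci η))) ^ k) *
                  GroupAlg.incl H (GroupAlg.pci η))) ∧
        GroupAlg.incl H (GroupAlg.pci η) = ∑ i, GroupAlg.pci (ρ i)) ∧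
    -- case (2): `e_η` is not central in `ℂ[G]`
    (GroupAlg.incl H (GroupAlg.pci η) ∉ Set.center (MonoidAlgebra ℂ G) →
      ∃ (n : ℕ) (ρ : Representation ℂ G (Fin n → ℂ)),
        ρ.IsIrreducible ∧
        (∀ i < p, Nonempty (Representation.Equiv
          (Representation.ind H.subtype (GroupAlg.conjRep η (x ^ i))) ρ)) ∧
        GroupAlg.pci ρ = ∑ i ∈ Finset.range p,
          GroupAlg.incl H (GroupAlg.pci (GroupAlg.conjRep η (x ^ i)))) :=
  ⟨GroupAlg.exists_extensions_of_mem_center hp hindex hx hη,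
    GroupAlg.exists_ind_equiv_of_notMem_center hp hindex hx hη⟩
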